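/- For a real matrix $A=(a_{ij})$ let $\operatorname{supp}(A)=\{(i,j): a_{ij}\neq 0\}$, and let $\mathbf 1_n$ be the all-ones column vector. An $n\times n$ nonnegative matrix $M$ is *fully indecomposable* if there are no permutation matrices $P_\ell,P_r$ such that $P_\ell M P_r=\begin{pmatrix} M_{11}&M_{12}\\0&M_{22}\end{pmatrix}$ with $M_{11}$ and $M_{22}$ square of positive size. The *Sinkhorn–Knopp-like algorithm* for a nonnegative matrix $M$ and prescribed row sums $r$ and column sums $c$ starts with the current matrix $M$ and with $D_\ell=I$, $D_r=I$, and alternately performs the following two steps, beginning with (1): (1) multiply each row $i$ of the current matrix and of $D_\ell$ by $r_i$ divided by the $i$-th row sum of the current matrix; (2) multiply each column $j$ of the current matrix and of $D_r$ by $c_j$ divided by the $j$-th column sum of the current matrix. Run without stopping, it *converges to $S$* if the sequence of current matrices (after every single step) converges to $S$, and the accumulated matrices $D_\ell,D_r$ converge to diagonal matrices $D_\ell^\infty,D_r^\infty$ with positive main diagonals, with $S=D_\ell^\infty M D_r^\infty$. **Theorem.** Let $M\in\mathbb R^{n\times n}$ be a nonnegative matrix with $(i,i)\in\operatorname{supp}(M)$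 for all $i=1,\dots,n$ and $\operatorname{supp}(M)=\operatorname{supp}(M^T)$. Let $v\in\mathbb R^{n}$ be a strictly positive vector. Then there exists a matrix $S=D_\ell M D_r$, where $D_\ell$ and $D_r$ are diagonal matrices with positive main diagonals, such that $S\mathbf 1_n=v$ and $\mathbf 1_n^TS=v^T$. This $S$ is the unique matrix of this form with these row and column sums, and the Sinkhorn–Knopp-like algorithm applied to $M$ with $r=c=v$ converges to $S$. If, in addition, $M$ is fully indecomposable, then: * $D_\ell$ and $D_r$ are unique up to a positive scalar multiple: if $S=D_\ell MD_r=D_\ell' MD_r'$ with all four matrices diagonal with positive main diagonals, then $D_\ell'=\alpha D_\ell$ and $D_r'=\alpha^{-1}D_r$ for some $\alpha>0$; * if moreover $M=M^T$, then there exists a unique diagonal matrix $D$ with positive diagonal entries such that $S=DMD$. -/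

import Mathlib

open scoped Matrix Topology

/-- The support of a real matrix: the set of positions of its nonzero entries. -/
def matSupp {m n : ℕ} (A : Matrix (Fin m) (Fin n) ℝ) : Set (Fin m × Fin n) :=
  {p | A p.1 p.2 ≠ 0}

/-- `D` is a diagonal matrix with positive main diagonal. -/
def IsPosDiag {n : ℕ} (D : Matrix (Fin n) (Fin n) ℝ) : Prop :=
  D.IsDiag ∧ ∀ i, 0 < D i i

/-- `S` is a two-sided positive diagonal scaling of `M` with row sums `r` and column sums `c`. -/
def IsScaledMatrix {m n : ℕ} (M : Matrix (Fin m) (Fin n) ℝ) (r : Fin m → ℝ) (c : Fin n → ℝ)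
    (S : Matrix (Fin m) (Fin n) ℝ) : Prop :=
  (∃ (Dl : Matrix (Fin m) (Fin m) ℝ) (Dr : Matrix (Fin n) (Fin n) ℝ),
    IsPosDiag Dl ∧ IsPosDiag Dr ∧ S = Dl * M * Dr) ∧
  S *ᵥ 1 = r ∧ 1 ᵥ* S = c

/-- `M` is fully indecomposable: no row and column permutations bring it to block upper
triangular form `[[M₁₁, M₁₂], [0, M₂₂]]` with (nonempty) square diagonal blocks `M₁₁`
(of size `k`) and `M₂₂` (of size `n - k`). -/
def IsFullyIndecomposable {n : ℕ} (M : Matrix (Fin n) (Fin n) ℝ) : Prop :=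
  ¬ ∃ (σ τ : Equiv.Perm (Fin n)) (k : ℕ), 0 < k ∧ k < n ∧
    ∀ i j : Fin n, k ≤ (i : ℕ) → (j : ℕ) < k → (M.submatrix σ τ) i j = 0

/-- The data updated by the Sinkhorn-Knopp-like algorithm: the current matrix and the
accumulated left and right diagonal scalings. -/
structure SKState (m n : ℕ) where
  mat : Matrix (Fin m) (Fin n) ℝ
  left : Matrix (Fin m) (Fin m) ℝ
  right : Matrix (Fin n) (Fin n) ℝ

/-- Multiply each row `i` of the current matrix and of the left scaling by
`r i / (sum of row i)`. -/
noncomputable def SKState.rowStep {m n : ℕ} (r : Fin m → ℝ) (s : SKState m n) : SKState m n where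
  mat := Matrix.of fun i j => r i / (∑ j', s.mat i j') * s.mat i j
  left := Matrix.of fun i k => r i / (∑ j', s.mat i j') * s.left i k
  right := s.right

/-- Multiply each column `j` of the current matrix and of the right scaling by
`c j / (sum of column j)`. -/
noncomputable def SKState.colStep {m n : ℕ} (c : Fin n → ℝ) (s : SKState m n) : SKState m n where
  mat := Matrix.of fun i j => s.mat i j * (c j / ∑ i', s.mat i' j)
  left := s.left
  right := Matrix.of fun k j => s.right k j * (c j / ∑ i', s.mat i' j)

/-- The states produced by the Sinkhorn-Knopp-like algorithm (run without stopping), starting from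
`M` with identity scalings and alternating row steps and column steps, beginning with a row step.
The state `skIterate M r c k` is the one after `k` such single steps. -/
noncomputable def skIterate {m n : ℕ} (M : Matrix (Fin m) (Fin n) ℝ) (r : Fin m → ℝ)
    (c : Fin n → ℝ) : ℕ → SKState m n
  | 0 => ⟨M, 1, 1⟩
  | k + 1 =>
    if Even k then (skIterate M r c k).rowStep r else (skIterate M r c k).colStep c

/-- The Sinkhorn-Knopp-like algorithm converges with limit `S`: the matrices converge to `S`, and
the accumulated scalings converge to diagonal matrices with positive main diagonals
that scale `M` to `S`. -/
def SKConvergesTo {m n : ℕ} (M : Matrix (Fin m) (Fin n) ℝ) (r : Fin m → ℝ) (c : Fin n → ℝ)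
    (S : Matrix (Fin m) (Fin n) ℝ) : Prop :=
  Filter.Tendsto (fun k => (skIterate M r c k).mat) Filter.atTop (𝓝 S) ∧
  ∃ (Dl : Matrix (Fin m) (Fin m) ℝ) (Dr : Matrix (Fin n) (Fin n) ℝ),
    IsPosDiag Dl ∧ IsPosDiag Dr ∧ S = Dl * M * Dr ∧
    Filter.Tendsto (fun k => (skIterate M r c k).left) Filter.atTop (𝓝 Dl) ∧
    Filter.Tendsto (fun k => (skIterate M r c k).right) Filter.atTop (𝓝 Dr)

open Filter

/-! ### Order and homogeneity of the Sinkhorn sweep. -/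

section Scaling

variable {ι : Type*} [Fintype ι]

/-! Existence is variational. Logarithms of scaling factors are critical points of
`scalingPotential`, which sees `x`, `y` only through the values `x i + y j` on the support. Since
both marginals equal `v`, its linear part involves only diagonal values, so the positive diagonal
makes these coercive. Off the diagonal only upper bounds are immediate; the symmetric support turns
them into lower bounds. Hence a minimum exists, with no indecomposability.

For convergence, any scaling `S` of `M` conjugates the sweep of `M` to that of `S` (`sweep_mul`).
The sweep of `S` is monotone, homogeneous and fixes `1`, so orbits stay in a box. The quantity `∑ v
j / q j` decreases by an explicit sum of squares (`sum_div_sub_sum_div_sweep`), so a cluster point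
rescales `S` to itself and is a fixed point; the invariant boxes around it force the whole orbit to
converge. As the algorithm does not depend on `S` but tends to it, `S` is unique.

Under full indecomposability, the ratio of two left scalings is constant along the support, hence
constant. For symmetric `M`, transposition makes the two factors proportional, and a square root
balances them. -/

/-- The row factors which give `M * diag r` the row sums `v`. -/
noncomputable def rowFactors (M : Matrix ι ι ℝ) (v r : ι → ℝ) : ι → ℝ :=
  fun i => v i / ∑ j, M i j * r j

/-- The update of the column factors in one full Sinkhorn sweep (a row step, then a column step). -/
noncomputable def sweep (M : Matrix ι ι ℝ) (v r : ι → ℝ) : ι → ℝ :=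
  rowFactors Mᵀ v (rowFactors M v r)

lemma sum_mul_pos {M : Matrix ι ι ℝ} (hM : ∀ i j, 0 ≤ M i j) {r : ι → ℝ} (hr : ∀ i, 0 < r i)
    {i : ι} (hd : 0 < M i i) : 0 < ∑ j, M i j * r j :=
  Finset.sum_pos' (fun j _ => mul_nonneg (hM i j) (hr j).le)
    ⟨i, Finset.mem_univ i, mul_pos hd (hr i)⟩

lemma rowFactors_pos {M : Matrix ι ι ℝ} (hM : ∀ i j, 0 ≤ M i j) (hd : ∀ i, 0 < M i i)
    {v r : ι → ℝ} (hv : ∀ i, 0 < v i) (hr : ∀ i, 0 < r i) (i : ι) : 0 < rowFactors M v r i :=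
  div_pos (hv i) (sum_mul_pos hM hr (hd i))

lemma sweep_pos {M : Matrix ι ι ℝ} (hM : ∀ i j, 0 ≤ M i j) (hd : ∀ i, 0 < M i i)
    {v r : ι → ℝ} (hv : ∀ i, 0 < v i) (hr : ∀ i, 0 < r i) (i : ι) : 0 < sweep M v r i :=
  rowFactors_pos (M := Mᵀ) (fun i j => hM j i) hd hv (rowFactors_pos hM hd hv hr) i

lemma iterate_sweep_pos {M : Matrix ι ι ℝ} (hM : ∀ i j, 0 ≤ M i j) (hd : ∀ i, 0 < M i i)
    {v r : ι → ℝ} (hv : ∀ i, 0 < v i) (hr : ∀ i, 0 < r i) (k : ℕ) (i : ι) :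
    0 < (sweep M v)^[k] r i := by
  induction k generalizing i with
  | zero => exact hr i
  | succ k ih =>
    rw [Function.iterate_succ_apply']
    exact sweep_pos hM hd hv ih i

lemma rowFactors_antitone {M : Matrix ι ι ℝ} (hM : ∀ i j, 0 ≤ M i j) (hd : ∀ i, 0 < M i i)
    {v r r' : ι → ℝ} (hv : ∀ i, 0 < v i) (hr : ∀ i, 0 < r i) (h : ∀ i, r i ≤ r' i) (i : ι) :
    rowFactors M v r' i ≤ rowFactors M v r i :=
  div_le_div_of_nonneg_left (hv i).le (sum_mul_pos hM hr (hd i))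
    (Finset.sum_le_sum fun j _ => mul_le_mul_of_nonneg_left (h j) (hM i j))

lemma sweep_monotone {M : Matrix ι ι ℝ} (hM : ∀ i j, 0 ≤ M i j) (hd : ∀ i, 0 < M i i)
    {v r r' : ι → ℝ} (hv : ∀ i, 0 < v i) (hr : ∀ i, 0 < r i) (h : ∀ i, r i ≤ r' i) (i : ι) :
    sweep M v r i ≤ sweep M v r' i :=
  rowFactors_antitone (M := Mᵀ) (fun i j => hM j i) hd hv
    (rowFactors_pos hM hd hv fun i => (hr i).trans_le (h i)) (rowFactors_antitone hM hd hv hr h) i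

lemma rowFactors_smul (M : Matrix ι ι ℝ) (v r : ι → ℝ) (a : ℝ) :
    rowFactors M v (a • r) = a⁻¹ • rowFactors M v r := by
  funext i
  simp only [rowFactors, Pi.smul_apply, smul_eq_mul, mul_left_comm _ a, ← Finset.mul_sum]
  rw [div_mul_eq_div_div_swap, div_eq_inv_mul]

lemma sweep_smul (M : Matrix ι ι ℝ) (v r : ι → ℝ) (a : ℝ) :
    sweep M v (a • r) = a • sweep M v r := by
  rw [sweep, rowFactors_smul, rowFactors_smul, inv_inv, sweep]

/-- The sweep preserves multiplicative bounds relative to a fixed point. -/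
lemma iterate_sweep_mem_bounds {M : Matrix ι ι ℝ} (hM : ∀ i j, 0 ≤ M i j) (hd : ∀ i, 0 < M i i)
    {v p r : ι → ℝ} (hv : ∀ i, 0 < v i) (hp : ∀ i, 0 < p i) (hfix : sweep M v p = p)
    {a b : ℝ} (ha : 0 < a) (h : ∀ i, a * p i ≤ r i ∧ r i ≤ b * p i) (k : ℕ) (i : ι) :
    a * p i ≤ (sweep M v)^[k] r i ∧ (sweep M v)^[k] r i ≤ b * p i := by
  induction k generalizing i with
  | zero => exact h i
  | succ k ih =>
    rw [Function.iterate_succ_apply']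
    have hap : ∀ i, 0 < (a • p) i := fun i => mul_pos ha (hp i)
    have h1 := sweep_monotone hM hd hv hap (fun i => (ih i).1) i
    have h2 := sweep_monotone (r' := b • p) hM hd hv
      (fun i => (hap i).trans_le (ih i).1) (fun i => (ih i).2) i
    rw [sweep_smul, hfix] at h1 h2
    exact ⟨h1, h2⟩

/-! ### Convergence for a balanced matrix. -/

/-- A Lyapunov identity: `v j / sweep S v q j` is a column sum of the row-scaled matrix, so the
second sum is `∑ c i * v i`. Expanding the square and using `c i * ∑ j, S i j * q j = v i` leaves
exactly the difference. -/
lemma sum_div_sub_sum_div_sweep {S : Matrix ι ι ℝ} (hS : ∀ i j, 0 ≤ S i j) (hd : ∀ i, 0 < S i i)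
    {v q : ι → ℝ} (hv : ∀ i, 0 < v i) (hrow : ∀ i, ∑ j, S i j = v i)
    (hcol : ∀ j, ∑ i, S i j = v j) (hq : ∀ i, 0 < q i) :
    ∑ j, v j / q j - ∑ j, v j / sweep S v q j =
      ∑ i, ∑ j, S i j * (1 - rowFactors S v q i * q j) ^ 2 / q j := by
  set c := rowFactors S v q with hc
  have hcp : ∀ i, 0 < c i := rowFactors_pos hS hd hv hq
  have h1 : ∑ j, v j / sweep S v q j = ∑ i, c i * v i := by
    have : ∀ j, v j / sweep S v q j = ∑ i, c i * S i j := fun j => by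
      have hs : 0 < ∑ i, Sᵀ j i * c i :=
        sum_mul_pos (M := Sᵀ) (fun i j => hS j i) hcp (hd j)
      rw [sweep, ← hc, rowFactors, div_div_cancel₀ (hv j).ne']
      exact Finset.sum_congr rfl fun i _ => mul_comm _ _
    simp only [this]
    rw [Finset.sum_comm]
    simp only [← Finset.mul_sum, hrow]
  have h2 : ∑ j, v j / q j = ∑ i, ∑ j, S i j / q j := by
    rw [Finset.sum_comm]
    simp only [← Finset.sum_div, hcol]
  rw [h1, h2, ← Finset.sum_sub_distrib]
  refine Finset.sum_congr rfl fun i _ => ?_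
  have h3 : c i * ∑ j, S i j * q j = v i := by
    rw [hc, rowFactors, div_mul_cancel₀ _ (sum_mul_pos hS hq (hd i)).ne']
  have h4 : ∀ j, S i j * (1 - c i * q j) ^ 2 / q j =
      S i j / q j - 2 * c i * S i j + c i * (c i * (S i j * q j)) := fun j => by
    have := (hq j).ne'
    field_simp
    ring
  simp only [h4, Finset.sum_add_distrib, Finset.sum_sub_distrib, ← Finset.mul_sum, hrow, h3]
  ring

lemma continuousAt_rowFactors {M : Matrix ι ι ℝ} (hM : ∀ i j, 0 ≤ M i j) (hd : ∀ i, 0 < M i i)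
    (v : ι → ℝ) {q : ι → ℝ} (hq : ∀ i, 0 < q i) : ContinuousAt (rowFactors M v) q := by
  refine continuousAt_pi.2 fun i => ?_
  refine ContinuousAt.div continuousAt_const ?_ (sum_mul_pos hM hq (hd i)).ne'
  exact (continuous_finsetSum _ fun j _ =>
    continuous_const.mul (continuous_apply j)).continuousAt

/-- Sinkhorn iteration on a matrix which already has the right row and column sums. -/
lemma tendsto_iterate_sweep_of_balanced {S : Matrix ι ι ℝ} (hS : ∀ i j, 0 ≤ S i j)
    (hd : ∀ i, 0 < S i i) {v : ι → ℝ} (hv : ∀ i, 0 < v i) (hrow : ∀ i, ∑ j, S i j = v i)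
    (hcol : ∀ j, ∑ i, S i j = v j) {r : ι → ℝ} (hr : ∀ i, 0 < r i) :
    ∃ q : ι → ℝ, (∀ i, 0 < q i) ∧ Tendsto (fun k => (sweep S v)^[k] r) atTop (𝓝 q) ∧
      ∀ i j, rowFactors S v q i * S i j * q j = S i j := by
  set u : ℕ → ι → ℝ := fun k => (sweep S v)^[k] r with hu
  have hsucc : ∀ k, u (k + 1) = sweep S v (u k) := fun k => Function.iterate_succ_apply' _ _ _
  have hupos : ∀ k i, 0 < u k i := iterate_sweep_pos hS hd hv hr
  have h1 : rowFactors S v 1 = 1 := by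
    funext i; simp [rowFactors, hrow, (hv i).ne']
  have h1' : rowFactors Sᵀ v 1 = 1 := by
    funext i; simp [rowFactors, hcol, (hv i).ne']
  have hfix1 : sweep S v 1 = 1 := by rw [sweep, h1, h1']
  obtain ⟨a, ha, har⟩ : ∃ a : ℝ, 0 < a ∧ ∀ i, a ≤ r i := by
    cases isEmpty_or_nonempty ι
    · exact ⟨1, one_pos, fun i => isEmptyElim i⟩
    · obtain ⟨i, hi⟩ := Finite.exists_min r
      exact ⟨r i, hr i, hi⟩
  obtain ⟨b, hb⟩ : ∃ b : ℝ, ∀ i, r i ≤ b :=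
    ⟨∑ i, r i, fun i => Finset.single_le_sum (fun j _ => (hr j).le) (Finset.mem_univ i)⟩
  have hbd : ∀ k i, a ≤ u k i ∧ u k i ≤ b := fun k i => by
    have := iterate_sweep_mem_bounds hS hd hv (p := 1) (r := r) (a := a) (b := b)
      (fun _ => one_pos) hfix1 ha (fun i => by simpa using ⟨har i, hb i⟩) k i
    simpa using this
  obtain ⟨q, hq, φ, hφ, hlim⟩ := (isCompact_univ_pi (s := fun _ : ι => Set.Icc a b)
    fun _ => isCompact_Icc).tendsto_subseq (x := u) (fun k i _ => hbd k i)
  have hqpos : ∀ i, 0 < q i := fun i => ha.trans_le (hq i (Set.mem_univ i)).1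
  have hdefect0 : ∀ p : ι → ℝ, (∀ i, 0 < p i) → ∀ i j,
      0 ≤ S i j * (1 - rowFactors S v p i * p j) ^ 2 / p j := fun p hp i j =>
    div_nonneg (mul_nonneg (hS i j) (sq_nonneg _)) (hp j).le
  have hdefect : Tendsto
      (fun k => ∑ i, ∑ j, S i j * (1 - rowFactors S v (u k) i * u k j) ^ 2 / u k j)
      atTop (𝓝 0) := by
    have hmono : Antitone fun k => ∑ j, v j / u k j := antitone_nat_of_succ_le fun k => by
      have := sum_div_sub_sum_div_sweep hS hd hv hrow hcol (hupos k)
      rw [hsucc, ← sub_nonneg, this]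
      exact Finset.sum_nonneg fun i _ => Finset.sum_nonneg fun j _ => hdefect0 _ (hupos k) i j
    have hbelow : BddBelow (Set.range fun k => ∑ j, v j / u k j) := by
      refine ⟨0, ?_⟩
      rintro _ ⟨k, rfl⟩
      exact Finset.sum_nonneg fun j _ => (div_pos (hv j) (hupos k j)).le
    have ht := tendsto_atTop_ciInf hmono hbelow
    have := ht.sub (ht.comp (tendsto_add_atTop_nat 1))
    rw [sub_self] at this
    refine this.congr fun k => ?_
    simp only [Function.comp]
    rw [hsucc, sum_div_sub_sum_div_sweep hS hd hv hrow hcol (hupos k)]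
  -- The defect is continuous at `q`, so it vanishes at the cluster point.
  have hdefectq : ∑ i, ∑ j, S i j * (1 - rowFactors S v q i * q j) ^ 2 / q j = 0 := by
    refine tendsto_nhds_unique ?_ (hdefect.comp hφ.tendsto_atTop)
    have hcoord : ∀ j, Tendsto (fun k => u (φ k) j) atTop (𝓝 (q j)) :=
      fun j => (tendsto_pi_nhds.1 hlim) j
    have hrf : ∀ i, Tendsto (fun k => rowFactors S v (u (φ k)) i) atTop
        (𝓝 (rowFactors S v q i)) :=
      fun i => (tendsto_pi_nhds.1 ((continuousAt_rowFactors hS hd v hqpos).tendsto.comp hlim)) i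
    refine tendsto_finsetSum _ fun i _ => tendsto_finsetSum _ fun j _ => ?_
    exact ((((hrf i).mul (hcoord j)).const_sub 1).pow 2 |>.const_mul (S i j)).div
      (hcoord j) (hqpos j).ne'
  have hbal : ∀ i j, S i j = rowFactors S v q i * S i j * q j := fun i j => by
    have e1 := (Finset.sum_eq_zero_iff_of_nonneg fun i _ =>
      Finset.sum_nonneg fun j _ => hdefect0 q hqpos i j).1 hdefectq i (Finset.mem_univ i)
    have e2 := (Finset.sum_eq_zero_iff_of_nonneg fun j _ => hdefect0 q hqpos i j).1 e1 j
      (Finset.mem_univ j)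
    rcases div_eq_zero_iff.1 e2 with h | h
    · rcases mul_eq_zero.1 h with h | h
      · simp [h]
      · have := pow_eq_zero_iff (two_ne_zero) |>.1 h
        linear_combination S i j * this
    · exact absurd h (hqpos j).ne'
  have hfix : sweep S v q = q := by
    funext j
    have : (∑ i, Sᵀ j i * rowFactors S v q i) * q j = v j := by
      rw [Finset.sum_mul, ← hcol j]
      refine Finset.sum_congr rfl fun i _ => ?_
      rw [Matrix.transpose_apply]
      linear_combination -hbal i j
    rw [sweep, rowFactors, ← this]
    refine mul_div_cancel_left₀ _ fun h => (hv j).ne ?_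
    rw [← this, h, zero_mul]
  refine ⟨q, hqpos, ?_, fun i j => (hbal i j).symm⟩
  -- Once a subsequence term lies between `(1 - δ) • q` and `(1 + δ) • q`, all later terms do, by
  -- invariance of these bounds.
  refine tendsto_pi_nhds.2 fun j => Metric.tendsto_atTop.2 fun ε hε => ?_
  obtain ⟨δ, hδ, hδ1, hδε⟩ : ∃ δ : ℝ, 0 < δ ∧ δ < 1 ∧ δ * q j < ε := by
    refine ⟨min (1 / 2) (ε / (2 * q j)), lt_min (by norm_num)
      (div_pos hε (mul_pos two_pos (hqpos j))), (min_le_left _ _).trans_lt (by norm_num), ?_⟩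
    calc _ ≤ ε / (2 * q j) * q j := by
            gcongr
            · exact (hqpos j).le
            · exact min_le_right _ _
      _ = ε / 2 := by have := (hqpos j).ne'; field_simp
      _ < ε := half_lt_self hε
  have hev : ∀ᶠ k in atTop, ∀ i, (1 - δ) * q i ≤ u (φ k) i ∧ u (φ k) i ≤ (1 + δ) * q i := by
    refine eventually_all.2 fun i => ?_
    have hi : Tendsto (fun k => u (φ k) i) atTop (𝓝 (q i)) := (tendsto_pi_nhds.1 hlim) i
    have hpos := mul_pos hδ (hqpos i)
    filter_upwards [hi.eventually_const_le (u := (1 - δ) * q i) (by linarith),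
      hi.eventually_le_const (u := (1 + δ) * q i) (by linarith)] with k h1 h2 using ⟨h1, h2⟩
  obtain ⟨k₀, hk₀⟩ := hev.exists
  refine ⟨φ k₀, fun k hk => ?_⟩
  obtain ⟨m, rfl⟩ := Nat.exists_eq_add_of_le hk
  have := iterate_sweep_mem_bounds hS hd hv hqpos hfix (sub_pos.2 hδ1) hk₀ m j
  have hum : (sweep S v)^[m] (u (φ k₀)) = u (φ k₀ + m) := by
    rw [hu, add_comm]
    exact (Function.iterate_add_apply _ _ _ _).symm
  rw [hum] at this
  rw [Real.dist_eq, abs_lt]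
  constructor <;> linarith [this.1, this.2]

/-! ### Transfer from the balanced matrix to `M`. -/

lemma rowFactors_mul {M S : Matrix ι ι ℝ} {v l r : ι → ℝ} (hl : ∀ i, 0 < l i)
    (hS : ∀ i j, S i j = l i * M i j * r j) (q : ι → ℝ) :
    rowFactors M v (r * q) = l * rowFactors S v q := by
  funext i
  have : ∑ j, S i j * q j = l i * ∑ j, M i j * (r * q) j := by
    rw [Finset.mul_sum]
    refine Finset.sum_congr rfl fun j _ => ?_
    rw [hS, Pi.mul_apply]; ring
  rw [Pi.mul_apply, rowFactors, rowFactors, this, ← mul_div_assoc,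
    mul_div_mul_left _ _ (hl i).ne']

lemma sweep_mul {M S : Matrix ι ι ℝ} {v l r : ι → ℝ} (hl : ∀ i, 0 < l i) (hr : ∀ i, 0 < r i)
    (hS : ∀ i j, S i j = l i * M i j * r j) (q : ι → ℝ) :
    sweep M v (r * q) = r * sweep S v q := by
  rw [sweep, rowFactors_mul hl hS, rowFactors_mul (M := Mᵀ) (S := Sᵀ) hr, sweep]
  intro i j
  rw [Matrix.transpose_apply, Matrix.transpose_apply, hS]; ring

/-- If `M` has a scaling `S` with row and column sums `v`, then the Sinkhorn iteration converges,
and the limiting factors scale `M` to `S`. -/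
lemma tendsto_iterate_sweep {M S : Matrix ι ι ℝ} (hM : ∀ i j, 0 ≤ M i j)
    (hd : ∀ i, 0 < M i i) {v l r : ι → ℝ} (hv : ∀ i, 0 < v i) (hl : ∀ i, 0 < l i)
    (hr : ∀ i, 0 < r i) (hS : ∀ i j, S i j = l i * M i j * r j) (hrow : ∀ i, ∑ j, S i j = v i)
    (hcol : ∀ j, ∑ i, S i j = v j) :
    ∃ p : ι → ℝ, (∀ i, 0 < p i) ∧ Tendsto (fun k => (sweep M v)^[k] 1) atTop (𝓝 p) ∧
      ∀ i j, S i j = rowFactors M v p i * M i j * p j := by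
  -- Since `1 = r * r⁻¹`, the orbit of `1` for `M` corresponds to that of `r⁻¹` for `S`.
  obtain ⟨q, hq, hlim, hbal⟩ := tendsto_iterate_sweep_of_balanced (S := S)
    (fun i j => by rw [hS]; exact mul_nonneg (mul_nonneg (hl i).le (hM i j)) (hr j).le)
    (fun i => by rw [hS]; exact mul_pos (mul_pos (hl i) (hd i)) (hr i)) hv hrow hcol
    (r := r⁻¹) (fun i => inv_pos.2 (hr i))
  refine ⟨r * q, fun i => mul_pos (hr i) (hq i), ?_, fun i j => ?_⟩
  · refine (hlim.const_mul r).congr fun k => ?_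
    induction k with
    | zero => funext i; simp [(hr i).ne']
    | succ k ih =>
      rw [Function.iterate_succ_apply', Function.iterate_succ_apply', ← ih, sweep_mul hl hr hS]
  · rw [rowFactors_mul hl hS, ← hbal i j, hS]
    simp only [Pi.mul_apply]
    ring

/-! ### Existence of a scaling by minimisation. -/

/-- The convex potential whose critical points are the logarithms of the scaling factors. -/
noncomputable def scalingPotential (M : Matrix ι ι ℝ) (v x y : ι → ℝ) : ℝ :=
  ∑ i, ∑ j, M i j * Real.exp (x i + y j) - ∑ i, v i * (x i + y i)

lemma scalingPotential_transpose (M : Matrix ι ι ℝ) (v x y : ι → ℝ) :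
    scalingPotential Mᵀ v y x = scalingPotential M v x y := by
  rw [scalingPotential, Finset.sum_comm, scalingPotential]
  simp only [Matrix.transpose_apply, add_comm]

/-- No derivative is needed: a Sinkhorn row step applied to `x` lowers the potential by `∑ (R i - v
i + v i * log (v i / R i))`, whose terms are nonnegative and vanish only when `R i = v i`. -/
lemma row_sum_of_forall_scalingPotential_le {M : Matrix ι ι ℝ} (hM : ∀ i j, 0 ≤ M i j)
    (hd : ∀ i, 0 < M i i) {v x y : ι → ℝ} (hv : ∀ i, 0 < v i)
    (hmin : ∀ x', scalingPotential M v x y ≤ scalingPotential M v x' y) (i : ι) :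
    ∑ j, M i j * Real.exp (x i + y j) = v i := by
  set R : ι → ℝ := fun i => ∑ j, M i j * Real.exp (x i + y j) with hR
  have hRpos : ∀ i, 0 < R i := fun i =>
    sum_mul_pos (r := fun j => Real.exp (x i + y j)) hM (fun j => Real.exp_pos _) (hd i)
  have hlog : ∀ i, 0 ≤ R i - v i + v i * Real.log (v i / R i) := fun i => by
    have h := Real.one_sub_inv_le_log_of_pos (div_pos (hv i) (hRpos i))
    have h2 := mul_le_mul_of_nonneg_left h (hv i).le
    have h3 : v i * (1 - (v i / R i)⁻¹) = v i - R i := by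
      have := (hv i).ne'
      rw [inv_div]; field_simp
    linarith
  have hle := hmin fun i => x i + Real.log (v i / R i)
  have hrow : ∀ i, ∑ j, M i j * Real.exp (x i + Real.log (v i / R i) + y j) = v i := fun i => by
    have : ∀ j, M i j * Real.exp (x i + Real.log (v i / R i) + y j) =
        v i / R i * (M i j * Real.exp (x i + y j)) := fun j => by
      rw [add_right_comm, Real.exp_add, Real.exp_log (div_pos (hv i) (hRpos i))]; ring
    simp only [this, ← Finset.mul_sum]
    exact div_mul_cancel₀ _ (hRpos i).ne'
  have hsum : ∑ i, (R i - v i + v i * Real.log (v i / R i)) ≤ 0 := by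
    simp only [scalingPotential, hrow] at hle
    have e : ∑ i, (R i - v i + v i * Real.log (v i / R i)) =
        ∑ i, ∑ j, M i j * Real.exp (x i + y j) - ∑ i, v i * (x i + y i) -
          (∑ i, v i - ∑ i, v i * (x i + Real.log (v i / R i) + y i)) := by
      simp only [← Finset.sum_sub_distrib]
      refine Finset.sum_congr rfl fun i _ => ?_
      simp only [hR]; ring
    linarith
  have hzero := (Finset.sum_eq_zero_iff_of_nonneg fun i _ => hlog i).1
    (le_antisymm hsum (Finset.sum_nonneg fun i _ => hlog i)) i (Finset.mem_univ i)
  by_contra hne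
  have hne' : (v i / R i)⁻¹ ≠ 1 := by
    rw [inv_div]
    intro h
    exact hne ((div_eq_one_iff_eq (hv i).ne').1 h)
  have h := Real.log_lt_sub_one_of_pos (inv_pos.2 (div_pos (hv i) (hRpos i))) hne'
  rw [Real.log_inv, inv_div] at h
  have h2 := mul_lt_mul_of_pos_left h (hv i)
  have h3 : v i * (R i / v i - 1) = R i - v i := by
    have := (hv i).ne'
    field_simp
  linarith

/-- Coercivity in one diagonal variable. For `t ≥ 0`, bound `exp t` below by its quadratic Taylor
polynomial and complete the square. -/
lemma mul_abs_sub_le_mul_exp_sub {m w : ℝ} (hm : 0 < m) (hw : 0 < w) (t : ℝ) :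
    w * |t| - 2 * w ^ 2 / m ≤ m * Real.exp t - w * t := by
  rcases le_total t 0 with ht | ht
  · rw [abs_of_nonpos ht]
    have : 0 ≤ 2 * w ^ 2 / m := by positivity
    have := mul_pos hm (Real.exp_pos t)
    linarith
  · rw [abs_of_nonneg ht]
    have h1 := mul_le_mul_of_nonneg_left (Real.quadratic_le_exp_of_nonneg ht) hm.le
    have h2 : 0 ≤ (m * t - 2 * w) ^ 2 / (2 * m) := by positivity
    have h3 : (m * t - 2 * w) ^ 2 / (2 * m) = m * t ^ 2 / 2 - 2 * w * t + 2 * w ^ 2 / m := by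
      field_simp; ring
    have h4 : 0 ≤ m * t := by positivity
    linarith

lemma exists_forall_scalingPotential_le {M : Matrix ι ι ℝ} (hM : ∀ i j, 0 ≤ M i j)
    (hd : ∀ i, 0 < M i i) (hsymm : ∀ i j, M i j = 0 → M j i = 0) {v : ι → ℝ}
    (hv : ∀ i, 0 < v i) :
    ∃ x y : ι → ℝ, ∀ x' y', scalingPotential M v x y ≤ scalingPotential M v x' y' := by
  classical
  -- Passing to `z = L (x, y)` removes the directions along which the potential is constant and
  -- would not be coercive.
  let L : ((ι → ℝ) × (ι → ℝ)) →ₗ[ℝ] (ι → ι → ℝ) :=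
    { toFun := fun p i j => if M i j = 0 then 0 else p.1 i + p.2 j
      map_add' := fun p q => by
        funext i j
        by_cases h : M i j = 0
        · simp [h]
        · simp only [h, if_false, Prod.fst_add, Prod.snd_add, Pi.add_apply]; ring
      map_smul' := fun a p => by
        funext i j
        by_cases h : M i j = 0
        · simp [h]
        · simp only [h, if_false, Prod.smul_fst, Prod.smul_snd, Pi.smul_apply, smul_eq_mul,
            RingHom.id_apply]; ring }
  have hL : ∀ p i j, L p i j = if M i j = 0 then 0 else p.1 i + p.2 j := fun _ _ _ => rfl
  let g : (ι → ι → ℝ) → ℝ := fun z =>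
    ∑ i, ∑ j, M i j * Real.exp (z i j) - ∑ i, v i * z i i
  have hg : Continuous g := by fun_prop
  have hgL : ∀ p, g (L p) = scalingPotential M v p.1 p.2 := fun p => by
    simp only [g, scalingPotential]
    congr 1
    · refine Finset.sum_congr rfl fun i _ => Finset.sum_congr rfl fun j _ => ?_
      rw [hL]
      by_cases h : M i j = 0
      · simp [h]
      · rw [if_neg h]
    · refine Finset.sum_congr rfl fun i _ => ?_
      rw [hL, if_neg (hd i).ne']
  set C : ι → ℝ := fun i => 2 * v i ^ 2 / M i i
  set B : ℝ := g 0 + ∑ i, C i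
  have hterm : ∀ z : ι → ι → ℝ, ∀ i,
      v i * |z i i| - C i ≤ M i i * Real.exp (z i i) - v i * z i i := fun z i =>
    mul_abs_sub_le_mul_exp_sub (hd i) (hv i) _
  have hME : ∀ (z : ι → ι → ℝ) i j, 0 ≤ M i j * Real.exp (z i j) := fun z i j =>
    mul_nonneg (hM i j) (Real.exp_pos _).le
  have hgsplit : ∀ z, g z + ∑ i, C i =
      ∑ i, (∑ j, M i j * Real.exp (z i j) - v i * z i i + C i) := fun z => by
    simp only [g, Finset.sum_add_distrib, Finset.sum_sub_distrib]
  have hrow0 : ∀ (z : ι → ι → ℝ) i,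
      v i * |z i i| ≤ ∑ j, M i j * Real.exp (z i j) - v i * z i i + C i := fun z i => by
    have := Finset.single_le_sum (fun j _ => hME z i j) (Finset.mem_univ i)
    linarith [hterm z i]
  -- After the shift by `C`, every row contributes a nonnegative amount, so each one is bounded by
  -- the total.
  have hrowB : ∀ z, g z ≤ g 0 → ∀ i,
      ∑ j, M i j * Real.exp (z i j) - v i * z i i + C i ≤ B := fun z hz i => by
    have := Finset.single_le_sum (f := fun i =>
      ∑ j, M i j * Real.exp (z i j) - v i * z i i + C i)
      (fun i _ => (mul_nonneg (hv i).le (abs_nonneg _)).trans (hrow0 z i)) (Finset.mem_univ i)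
    rw [← hgsplit] at this
    linarith
  have hdiag : ∀ z, g z ≤ g 0 → ∀ i, |z i i| ≤ B / v i := fun z hz i => by
    rw [le_div_iff₀' (hv i)]
    exact (hrow0 z i).trans (hrowB z hz i)
  have hoff : ∀ z, g z ≤ g 0 → ∀ i j, i ≠ j → M i j ≠ 0 → z i j ≤ B / M i j :=
      fun z hz i j hij hm => by
    have hmp : 0 < M i j := lt_of_le_of_ne (hM i j) (Ne.symm hm)
    rw [le_div_iff₀' hmp]
    have h1 : M i i * Real.exp (z i i) + M i j * Real.exp (z i j) ≤
        ∑ k, M i k * Real.exp (z i k) := by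
      rw [← Finset.sum_pair (f := fun k => M i k * Real.exp (z i k)) hij]
      exact Finset.sum_le_sum_of_subset_of_nonneg (Finset.subset_univ _)
        fun k _ _ => hME z i k
    have h2 := hterm z i
    have h3 := hrowB z hz i
    have h4 : 0 ≤ v i * |z i i| := mul_nonneg (hv i).le (abs_nonneg _)
    have h5 : M i j * z i j ≤ M i j * Real.exp (z i j) :=
      mul_le_mul_of_nonneg_left (by linarith [Real.add_one_le_exp (z i j)]) hmp.le
    linarith
  let K : Set (ι → ι → ℝ) := {z | z ∈ LinearMap.range L ∧ g z ≤ g 0}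
  have hKclosed : IsClosed K :=
    (Submodule.closed_of_finiteDimensional (LinearMap.range L)).inter
      (isClosed_le hg continuous_const)
  let U : ι → ι → ℝ := fun i j => |B / v i| + |B / M i j|
  have hU : ∀ i j, 0 ≤ U i j := fun i j => by positivity
  have hup : ∀ z ∈ K, ∀ i j, z i j ≤ U i j := by
    rintro _ ⟨⟨p, rfl⟩, hz⟩ i j
    by_cases h : M i j = 0
    · rw [hL, if_pos h]; exact hU i j
    · by_cases hij : i = j
      · subst hij
        exact (le_abs_self _).trans ((hdiag _ hz i).trans
          ((le_abs_self _).trans (le_add_of_nonneg_right (abs_nonneg _))))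
      · exact (hoff _ hz i j hij h).trans
          ((le_abs_self _).trans (le_add_of_nonneg_left (abs_nonneg _)))
  have hlowdiag : ∀ z ∈ K, ∀ i, -U i i ≤ z i i := fun z hz i => by
    have h1 := (abs_le.1 (hdiag z hz.2 i)).1
    have h2 : B / v i ≤ U i i :=
      (le_abs_self _).trans (le_add_of_nonneg_right (abs_nonneg _))
    linarith
  -- On the support `z i j = z i i + z j j - z j i`, with `(j, i)` also in the support.
  have hlow : ∀ z ∈ K, ∀ i j, -U i i - U j j - U j i ≤ z i j := by
    intro z hz i j
    have h1 := hlowdiag z hz i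
    have h2 := hlowdiag z hz j
    have h3 := hup z hz j i
    obtain ⟨⟨p, rfl⟩, -⟩ := hz
    by_cases h : M i j = 0
    · rw [hL p i j, if_pos h]
      linarith [hU i i, hU j j, hU j i]
    · have h' : M j i ≠ 0 := fun h0 => h (hsymm _ _ h0)
      simp only [hL, if_neg h, if_neg h', if_neg (hd i).ne', if_neg (hd j).ne'] at *
      linarith
  have hKcompact : IsCompact K := by
    refine (isCompact_univ_pi (s := fun i => Set.univ.pi fun j =>
      Set.Icc (-U i i - U j j - U j i) (U i j))
      fun i => isCompact_univ_pi fun j => isCompact_Icc).of_isClosed_subset hKclosed ?_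
    exact fun z hz i _ j _ => ⟨hlow z hz i j, hup z hz i j⟩
  have h0 : (0 : ι → ι → ℝ) ∈ K := ⟨Submodule.zero_mem _, le_rfl⟩
  obtain ⟨z, hz, hzmin⟩ := hKcompact.exists_isMinOn ⟨0, h0⟩ hg.continuousOn
  obtain ⟨⟨p, rfl⟩, hz0⟩ := hz
  refine ⟨p.1, p.2, fun x' y' => ?_⟩
  rw [← hgL p, ← hgL (x', y')]
  rcases le_total (g (L (x', y'))) (g 0) with h | h
  · exact hzmin ⟨⟨_, rfl⟩, h⟩
  · exact hz0.trans h

/-- Existence of a positive diagonal scaling with prescribed symmetric marginals. -/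
lemma exists_scaling {M : Matrix ι ι ℝ} (hM : ∀ i j, 0 ≤ M i j)
    (hd : ∀ i, 0 < M i i) (hsymm : ∀ i j, M i j = 0 → M j i = 0) {v : ι → ℝ}
    (hv : ∀ i, 0 < v i) :
    ∃ l r : ι → ℝ, (∀ i, 0 < l i) ∧ (∀ i, 0 < r i) ∧ (∀ i, ∑ j, l i * M i j * r j = v i) ∧
      ∀ j, ∑ i, l i * M i j * r j = v j := by
  obtain ⟨x, y, hmin⟩ := exists_forall_scalingPotential_le hM hd hsymm hv
  refine ⟨fun i => Real.exp (x i), fun i => Real.exp (y i), fun i => Real.exp_pos _,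
    fun i => Real.exp_pos _, fun i => ?_, fun j => ?_⟩
  · rw [← row_sum_of_forall_scalingPotential_le hM hd hv (fun x' => hmin x' y) i]
    refine Finset.sum_congr rfl fun j _ => ?_
    rw [Real.exp_add]; ring
  · rw [← row_sum_of_forall_scalingPotential_le (M := Mᵀ) (x := y) (y := x) (fun i j => hM j i) hd
      hv (fun y' => by simpa only [scalingPotential_transpose] using hmin x y') j]
    refine Finset.sum_congr rfl fun i _ => ?_
    rw [Real.exp_add, Matrix.transpose_apply]; ring

end Scaling

/-! ### The algorithm in terms of sweeps. -/

lemma isPosDiag_diagonal {n : ℕ} {d : Fin n → ℝ} (hd : ∀ i, 0 < d i) :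
    IsPosDiag (Matrix.diagonal d) :=
  ⟨Matrix.isDiag_diagonal d, fun i => by simpa using hd i⟩

lemma IsPosDiag.exists_eq_diagonal {n : ℕ} {D : Matrix (Fin n) (Fin n) ℝ} (h : IsPosDiag D) :
    ∃ d : Fin n → ℝ, (∀ i, 0 < d i) ∧ D = Matrix.diagonal d :=
  ⟨fun i => D i i, h.2, h.1.diagonal_diag.symm⟩

lemma diagonal_mul_mul_diagonal_apply {n : ℕ} (l r : Fin n → ℝ) (M : Matrix (Fin n) (Fin n) ℝ)
    (i j : Fin n) : (Matrix.diagonal l * M * Matrix.diagonal r) i j = l i * M i j * r j := by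
  rw [Matrix.mul_diagonal, Matrix.diagonal_mul]

lemma isScaledMatrix_iff {n : ℕ} {M S : Matrix (Fin n) (Fin n) ℝ} {v w : Fin n → ℝ} :
    IsScaledMatrix M v w S ↔ (∃ l r : Fin n → ℝ, (∀ i, 0 < l i) ∧ (∀ i, 0 < r i) ∧
      ∀ i j, S i j = l i * M i j * r j) ∧ (∀ i, ∑ j, S i j = v i) ∧ ∀ j, ∑ i, S i j = w j := by
  refine and_congr ⟨?_, ?_⟩ (and_congr ?_ ?_)
  · rintro ⟨Dl, Dr, hl, hr, rfl⟩
    obtain ⟨l, hl', rfl⟩ := hl.exists_eq_diagonal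
    obtain ⟨r, hr', rfl⟩ := hr.exists_eq_diagonal
    exact ⟨l, r, hl', hr', diagonal_mul_mul_diagonal_apply l r M⟩
  · rintro ⟨l, r, hl, hr, h⟩
    refine ⟨_, _, isPosDiag_diagonal hl, isPosDiag_diagonal hr, ?_⟩
    ext i j
    rw [h, diagonal_mul_mul_diagonal_apply]
  · rw [funext_iff]
    simp [Matrix.mulVec, dotProduct]
  · rw [funext_iff]
    simp [Matrix.vecMul, dotProduct]

/-- The old left factor cancels, so the column factors alone determine the new state. -/
lemma rowStep_diagonal {n : ℕ} {M : Matrix (Fin n) (Fin n) ℝ} {v l r : Fin n → ℝ}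
    (hl : ∀ i, 0 < l i) :
    SKState.rowStep v ⟨Matrix.diagonal l * M * Matrix.diagonal r, Matrix.diagonal l,
      Matrix.diagonal r⟩ = ⟨Matrix.diagonal (rowFactors M v r) * M * Matrix.diagonal r,
      Matrix.diagonal (rowFactors M v r), Matrix.diagonal r⟩ := by
  have hfac : ∀ i, v i / (∑ j, l i * M i j * r j) * l i = rowFactors M v r i := fun i => by
    simp only [mul_assoc, ← Finset.mul_sum, rowFactors]
    rw [div_mul_eq_mul_div, mul_comm (v i), mul_div_mul_left _ _ (hl i).ne']
  simp only [SKState.rowStep, diagonal_mul_mul_diagonal_apply, SKState.mk.injEq, and_true]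
  constructor
  · ext i j
    rw [diagonal_mul_mul_diagonal_apply, ← hfac, Matrix.of_apply]; ring
  · ext i j
    by_cases h : i = j
    · subst h
      simp [hfac]
    · simp [Matrix.diagonal_apply_ne _ h]

lemma colStep_diagonal {n : ℕ} {M : Matrix (Fin n) (Fin n) ℝ} {v l r : Fin n → ℝ}
    (hr : ∀ i, 0 < r i) :
    SKState.colStep v ⟨Matrix.diagonal l * M * Matrix.diagonal r, Matrix.diagonal l,
      Matrix.diagonal r⟩ = ⟨Matrix.diagonal l * M * Matrix.diagonal (rowFactors Mᵀ v l),
      Matrix.diagonal l, Matrix.diagonal (rowFactors Mᵀ v l)⟩ := by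
  have hfac : ∀ j, r j * (v j / (∑ i, l i * M i j * r j)) = rowFactors Mᵀ v l j := fun j => by
    simp only [← Finset.sum_mul, rowFactors, Matrix.transpose_apply, mul_comm (l _)]
    rw [← mul_div_assoc, mul_comm (r j), mul_div_mul_right _ _ (hr j).ne']
  simp only [SKState.colStep, diagonal_mul_mul_diagonal_apply, SKState.mk.injEq, true_and]
  constructor
  · ext i j
    rw [diagonal_mul_mul_diagonal_apply, ← hfac, Matrix.of_apply]; ring
  · ext i j
    by_cases h : i = j
    · subst h
      simp [hfac]
    · simp [Matrix.diagonal_apply_ne _ h]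

/-- Left and right factors are updated on alternate steps, hence the two halved indices. The initial
state is excluded because its left factor `1` need not come from `rowFactors`. -/
lemma skIterate_succ_eq {n : ℕ} {M : Matrix (Fin n) (Fin n) ℝ} (hM : ∀ i j, 0 ≤ M i j)
    (hd : ∀ i, 0 < M i i) {v : Fin n → ℝ} (hv : ∀ i, 0 < v i) (k : ℕ) :
    skIterate M v v (k + 1) =
      ⟨Matrix.diagonal (rowFactors M v ((sweep M v)^[k / 2] 1)) * M *
        Matrix.diagonal ((sweep M v)^[(k + 1) / 2] 1),
      Matrix.diagonal (rowFactors M v ((sweep M v)^[k / 2] 1)),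
      Matrix.diagonal ((sweep M v)^[(k + 1) / 2] 1)⟩ := by
  have hpos := iterate_sweep_pos hM hd hv (r := 1) (fun _ => one_pos)
  induction k with
  | zero =>
    have := rowStep_diagonal (M := M) (v := v) (l := 1) (r := 1) (fun _ => one_pos)
    simpa [skIterate, Matrix.diagonal_one] using this
  | succ k ih =>
    rw [skIterate, ih]
    split_ifs with h
    · have e : (k + 1 + 1) / 2 = (k + 1) / 2 := by grind
      rw [rowStep_diagonal (rowFactors_pos hM hd hv (hpos _)), e]
    · have e : (k + 1) / 2 = k / 2 := by grind
      have e' : (k + 1 + 1) / 2 = k / 2 + 1 := by grind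
      rw [colStep_diagonal (hpos _), e, e', Function.iterate_succ_apply', sweep]

lemma IsScaledMatrix.skConvergesTo {n : ℕ} {M S : Matrix (Fin n) (Fin n) ℝ}
    (hM : ∀ i j, 0 ≤ M i j) (hd : ∀ i, 0 < M i i) {v : Fin n → ℝ} (hv : ∀ i, 0 < v i)
    (h : IsScaledMatrix M v v S) : SKConvergesTo M v v S := by
  obtain ⟨⟨l, r, hl, hr, hS⟩, hrow, hcol⟩ := isScaledMatrix_iff.1 h
  obtain ⟨p, hp, hlim, hSp⟩ := tendsto_iterate_sweep hM hd hv hl hr hS hrow hcol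
  have hhalf : Tendsto (fun k : ℕ => k / 2) atTop atTop :=
    Nat.tendsto_div_const_atTop two_ne_zero
  have hS' : S = Matrix.diagonal (rowFactors M v p) * M * Matrix.diagonal p := by
    ext i j
    rw [hSp, diagonal_mul_mul_diagonal_apply]
  have hdiag : Continuous fun d : Fin n → ℝ => Matrix.diagonal d :=
    continuous_id.matrix_diagonal
  have hleft : Tendsto (fun k : ℕ => Matrix.diagonal (rowFactors M v ((sweep M v)^[k / 2] 1)))
      atTop (𝓝 (Matrix.diagonal (rowFactors M v p))) :=
    (hdiag.tendsto _).comp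
      ((continuousAt_rowFactors hM hd v hp).tendsto.comp (hlim.comp hhalf))
  have hright : Tendsto (fun k : ℕ => Matrix.diagonal ((sweep M v)^[(k + 1) / 2] 1))
      atTop (𝓝 (Matrix.diagonal p)) :=
    (hdiag.tendsto _).comp (hlim.comp (hhalf.comp (tendsto_add_atTop_nat 1)))
  refine ⟨?_, _, _, isPosDiag_diagonal (rowFactors_pos hM hd hv hp), isPosDiag_diagonal hp, hS',
    ?_, ?_⟩ <;> rw [← tendsto_add_atTop_iff_nat 1] <;>
    simp only [skIterate_succ_eq hM hd hv]
  · rw [hS']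
    exact (hleft.mul tendsto_const_nhds).mul hright
  · exact hleft
  · exact hright

/-! ### Full indecomposability and uniqueness of the factors. -/

/-- A function on the indices of a fully indecomposable matrix which is constant along the
support is constant. -/
lemma IsFullyIndecomposable.eq_of_forall_ne_zero {n : ℕ} {M : Matrix (Fin n) (Fin n) ℝ}
    (hM : IsFullyIndecomposable M) {a : Fin n → ℝ} (ha : ∀ i j, M i j ≠ 0 → a i = a j)
    (i j : Fin n) : a i = a j := by
  classical
  by_contra hij
  refine hM ?_
  let k := Fintype.card {x // a x = a j}
  have hk0 : 0 < k := Fintype.card_pos_iff.2 ⟨⟨j, rfl⟩⟩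
  have hkn : k < n := by
    have := Fintype.card_subtype_lt (p := fun x => a x = a j) (x := i) hij
    rwa [Fintype.card_fin] at this
  have hcard : Fintype.card {x : Fin n // (x : ℕ) < k} = Fintype.card {x // a x = a j} := by
    rw [Fintype.card_congr (Fin.castLEquiv hkn.le).symm, Fintype.card_fin]
  let e := Fintype.equivOfCardEq hcard
  -- One permutation, used for rows and columns, puts the level set of `a j` first; no support entry
  -- joins it to its complement.
  refine ⟨e.extendSubtype, e.extendSubtype, k, hk0, hkn, fun x y hx hy => ?_⟩
  have h1 : ¬ a (e.extendSubtype x) = a j := e.extendSubtype_not_mem x (not_lt.2 hx)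
  have h2 : a (e.extendSubtype y) = a j := e.extendSubtype_mem y hy
  by_contra h
  exact h1 ((ha _ _ h).trans h2)

/-- On the support `l' i / l i = r j / r' j`; the diagonal identifies the right side with `l' j / l
j`, so this ratio is constant along the support. -/
lemma IsFullyIndecomposable.scaling_unique {n : ℕ} {M : Matrix (Fin n) (Fin n) ℝ}
    (hM : IsFullyIndecomposable M) (hd : ∀ i, 0 < M i i)
    {Dl Dr Dl' Dr' : Matrix (Fin n) (Fin n) ℝ} (hDl : IsPosDiag Dl) (hDr : IsPosDiag Dr)
    (hDl' : IsPosDiag Dl') (hDr' : IsPosDiag Dr') (h : Dl * M * Dr = Dl' * M * Dr') :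
    ∃ α : ℝ, 0 < α ∧ Dl' = α • Dl ∧ Dr' = α⁻¹ • Dr := by
  obtain ⟨l, hl, rfl⟩ := hDl.exists_eq_diagonal
  obtain ⟨r, hr, rfl⟩ := hDr.exists_eq_diagonal
  obtain ⟨l', hl', rfl⟩ := hDl'.exists_eq_diagonal
  obtain ⟨r', hr', rfl⟩ := hDr'.exists_eq_diagonal
  have hsupp : ∀ i j, M i j ≠ 0 → l i * r j = l' i * r' j := fun i j hij => by
    have := congrFun (congrFun h i) j
    rw [diagonal_mul_mul_diagonal_apply, diagonal_mul_mul_diagonal_apply] at this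
    exact mul_right_cancel₀ hij (by linarith)
  have hdiag : ∀ i, l' i / l i = r i / r' i := fun i => by
    rw [div_eq_div_iff (hl i).ne' (hr' i).ne']
    linarith [hsupp i i (hd i).ne']
  have hconst := hM.eq_of_forall_ne_zero (a := fun i => l' i / l i) fun i j hij => by
    rw [hdiag j, div_eq_div_iff (hl i).ne' (hr' j).ne']
    linarith [hsupp i j hij]
  rcases Nat.eq_zero_or_pos n with rfl | hn
  · exact ⟨1, one_pos, Subsingleton.elim _ _, Subsingleton.elim _ _⟩
  set i₀ : Fin n := ⟨0, hn⟩
  refine ⟨l' i₀ / l i₀, div_pos (hl' _) (hl _), ?_, ?_⟩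
  · rw [← Matrix.diagonal_smul]
    congr 1
    funext i
    rw [Pi.smul_apply, smul_eq_mul, hconst i₀ i, div_mul_cancel₀ _ (hl i).ne']
  · rw [← Matrix.diagonal_smul]
    congr 1
    funext i
    rw [Pi.smul_apply, smul_eq_mul, hconst i₀ i]
    rw [hdiag i, inv_div, div_mul_cancel₀ _ (hr i).ne']

lemma IsFullyIndecomposable.existsUnique_symm_scaling {n : ℕ} {M S : Matrix (Fin n) (Fin n) ℝ}
    (hM : IsFullyIndecomposable M) (hd : ∀ i, 0 < M i i) (hMT : M = Mᵀ)
    (hST : S = Sᵀ) (hS : ∃ Dl Dr, IsPosDiag Dl ∧ IsPosDiag Dr ∧ S = Dl * M * Dr) :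
    ∃! D : Matrix (Fin n) (Fin n) ℝ, IsPosDiag D ∧ S = D * M * D := by
  obtain ⟨Dl, Dr, hl, hr, hS⟩ := hS
  have hS' : Dl * M * Dr = Dr * M * Dl := by
    rw [← hS, hST, hS, Matrix.transpose_mul, Matrix.transpose_mul, ← hMT, hl.1.isSymm.eq,
      hr.1.isSymm.eq, Matrix.mul_assoc]
  obtain ⟨α, hα, rfl, -⟩ := hM.scaling_unique hd hl hr hr hl hS'
  refine ⟨√α • Dl, ⟨⟨hl.1.smul _, fun i => mul_pos (Real.sqrt_pos.2 hα) (hl.2 i)⟩, ?_⟩, ?_⟩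
  · rw [hS, Matrix.smul_mul, Matrix.smul_mul, Matrix.mul_smul, Matrix.mul_smul, smul_smul,
      Real.mul_self_sqrt hα.le]
  · rintro D ⟨hD, hSD⟩
    have hD₀ : IsPosDiag (√α • Dl) :=
      ⟨hl.1.smul _, fun i => mul_pos (Real.sqrt_pos.2 hα) (hl.2 i)⟩
    obtain ⟨β, hβ, h1, h2⟩ := hM.scaling_unique hd hD₀ hD₀ hD hD (by
      rw [← hSD, hS, Matrix.smul_mul, Matrix.smul_mul, Matrix.mul_smul, Matrix.mul_smul, smul_smul,
        Real.mul_self_sqrt hα.le])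
    rcases Nat.eq_zero_or_pos n with rfl | hn
    · exact Subsingleton.elim _ _
    have h3 := congrFun (congrFun (h1.symm.trans h2) ⟨0, hn⟩) ⟨0, hn⟩
    have h4 : β = β⁻¹ := mul_right_cancel₀ (hD₀.2 ⟨0, hn⟩).ne' h3
    have h5 : β * β = 1 := by
      nth_rewrite 2 [h4]
      exact mul_inv_cancel₀ hβ.ne'
    have h6 : β = 1 := by nlinarith
    rw [h1, h6, one_smul]

lemma IsScaledMatrix.transpose {n : ℕ} {M S : Matrix (Fin n) (Fin n) ℝ} {v w : Fin n → ℝ}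
    (h : IsScaledMatrix M v w S) : IsScaledMatrix Mᵀ w v Sᵀ := by
  rw [isScaledMatrix_iff] at *
  obtain ⟨⟨l, r, hl, hr, hS⟩, hrow, hcol⟩ := h
  refine ⟨⟨r, l, hr, hl, fun i j => ?_⟩, hcol, hrow⟩
  rw [Matrix.transpose_apply, Matrix.transpose_apply, hS]; ring

theorem theorem3p10 (n : ℕ) (M : Matrix (Fin n) (Fin n) ℝ)
    (hM : ∀ i j, 0 ≤ M i j)
    (hdiag : ∀ i, (i, i) ∈ matSupp M)
    (hsupp : matSupp M = matSupp Mᵀ)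
    (v : Fin n → ℝ) (hv : ∀ i, 0 < v i) :
    ∃ S : Matrix (Fin n) (Fin n) ℝ,
      IsScaledMatrix M v v S ∧
      (∀ S' : Matrix (Fin n) (Fin n) ℝ, IsScaledMatrix M v v S' → S' = S) ∧
      SKConvergesTo M v v S ∧
      (IsFullyIndecomposable M →
        (∀ Dl Dr Dl' Dr' : Matrix (Fin n) (Fin n) ℝ,
          IsPosDiag Dl → IsPosDiag Dr → IsPosDiag Dl' → IsPosDiag Dr' →
          S = Dl * M * Dr → S = Dl' * M * Dr' →
          ∃ α : ℝ, 0 < α ∧ Dl' = α • Dl ∧ Dr' = α⁻¹ • Dr) ∧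
        (M = Mᵀ → ∃! D : Matrix (Fin n) (Fin n) ℝ, IsPosDiag D ∧ S = D * M * D)) := by
  have hd : ∀ i, 0 < M i i := fun i => lt_of_le_of_ne (hM i i) (Ne.symm (hdiag i))
  have hsymm : ∀ i j, M i j = 0 → M j i = 0 := fun i j hij => by
    by_contra hji
    have : (j, i) ∈ matSupp Mᵀ := hsupp ▸ (show (j, i) ∈ matSupp M from hji)
    exact this hij
  obtain ⟨l, r, hl, hr, hrow, hcol⟩ := exists_scaling hM hd hsymm hv
  have hS : IsScaledMatrix M v v (Matrix.of fun i j => l i * M i j * r j) :=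
    isScaledMatrix_iff.2 ⟨⟨l, r, hl, hr, fun _ _ => rfl⟩, hrow, hcol⟩
  set S : Matrix (Fin n) (Fin n) ℝ := Matrix.of fun i j => l i * M i j * r j
  -- The iteration depends only on `M` and `v`, yet it converges to every admissible scaling.
  have huniq : ∀ S', IsScaledMatrix M v v S' → S' = S := fun S' hS' =>
    tendsto_nhds_unique (hS'.skConvergesTo hM hd hv).1 (hS.skConvergesTo hM hd hv).1
  refine ⟨S, hS, huniq, hS.skConvergesTo hM hd hv, fun hFI => ⟨?_, fun hMT => ?_⟩⟩
  · intro Dl Dr Dl' Dr' h1 h2 h3 h4 h5 h6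
    exact hFI.scaling_unique hd h1 h2 h3 h4 (h5.symm.trans h6)
  · refine hFI.existsUnique_symm_scaling hd hMT (huniq Sᵀ ?_).symm hS.1
    have := hS.transpose
    rwa [← hMT] at this
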